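/- For $0<\alpha<1$ and $u\in(0,1)$ set $$b_\alpha(u)=\frac{\sin(\pi u)}{\sin^{\alpha}(\pi\alpha u)\,\sin^{1-\alpha}(\pi(1-\alpha)u)},$$ and $b_0(u)=1$ (the limit as $\alpha\to0$, in agreement with the convention $0^0=1$, which is used throughout). Let $\mathbf K_\alpha=b_\alpha(\mathbf U)$ be the Kanter random variable, where $\mathbf U$ is uniform on $(0,1)$. For real random variables $X,Y$ write $X\le_{st}Y$ if $\mathbb E[\varphi(X)]\le\mathbb E[\varphi(Y)]$ for all increasing (i.e. nondecreasing) functions $\varphi:\mathbb R\to\mathbb R$ such that both expectations exist, and $X\prec_{cx}Y$ if this inequality holds for all convex functions $\varphi:\mathbb R\to\mathbb R$ such that both expectations exist. For positive random variables $X,Y$ write $X\prec_{st}Y$ (optimal stochastic order) if $X\le_{st}Y$ and there is no $c>1$ such that $cX\le_{st}Y$. Then for every $0\le\beta<\alpha\le 1/2$ one has $$\alpha^\alpha(1-\alpha)^{1-\alpha}\,\mathbf K_\alpha\;\prec_{st}\;\beta^\beta(1-\beta)^{1-\beta}\,\mathbf K_\beta \qquad\text{and}\qquad \Gamma(1+\beta)\Gamma(2-\beta)\,\mathbf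 K_\beta\;\prec_{cx}\;\Gamma(1+\alpha)\Gamma(2-\alpha)\,\mathbf K_\alpha,$$ and for every $0\le\beta<\alpha<1$ one has $$\alpha^{\frac{\alpha}{1-\alpha}}(1-\alpha)\,\mathbf K_\alpha^{\frac1{1-\alpha}}\;\prec_{st}\;\beta^{\frac{\beta}{1-\beta}}(1-\beta)\,\mathbf K_\beta^{\frac1{1-\beta}} \qquad\text{and}\qquad (1-\beta)\,\mathbf K_\beta^{\frac1{1-\beta}}\;\prec_{cx}\;(1-\alpha)\,\mathbf K_\alpha^{\frac1{1-\alpha}}.$$ -/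

import Mathlib

open MeasureTheory

/-- The usual stochastic order `X ≤_st Y` of two real random variables, defined on possibly
different probability spaces: `E[φ(X)] ≤ E[φ(Y)]` for every increasing (nondecreasing) function
`φ : ℝ → ℝ` such that both expectations exist. -/
def StochLE {Ω Ω' : Type*} [MeasurableSpace Ω] [MeasurableSpace Ω']
    (P : Measure Ω) (X : Ω → ℝ) (Q : Measure Ω') (Y : Ω' → ℝ) : Prop :=
  ∀ φ : ℝ → ℝ, Monotone φ →
    Integrable (fun ω => φ (X ω)) P → Integrable (fun ω => φ (Y ω)) Q →
      ∫ ω, φ (X ω) ∂P ≤ ∫ ω, φ (Y ω) ∂Q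

/-- The optimal stochastic order `X ≺_st Y` of two positive random variables: `X ≤_st Y`, and
there is no constant `c > 1` such that `c X ≤_st Y`. (The relation is only considered between
almost surely positive random variables, and this is recorded in the definition.) -/
def OptStochLE {Ω Ω' : Type*} [MeasurableSpace Ω] [MeasurableSpace Ω']
    (P : Measure Ω) (X : Ω → ℝ) (Q : Measure Ω') (Y : Ω' → ℝ) : Prop :=
  (∀ᵐ ω ∂P, 0 < X ω) ∧ (∀ᵐ ω ∂Q, 0 < Y ω) ∧
    StochLE P X Q Y ∧ ¬ ∃ c : ℝ, 1 < c ∧ StochLE P (fun ω => c * X ω) Q Y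

/-- The convex order `X ≺_cx Y` of two real random variables, defined on possibly different
probability spaces: `E[φ(X)] ≤ E[φ(Y)]` for every convex function `φ : ℝ → ℝ` such that both
expectations exist. -/
def ConvexLE {Ω Ω' : Type*} [MeasurableSpace Ω] [MeasurableSpace Ω']
    (P : Measure Ω) (X : Ω → ℝ) (Q : Measure Ω') (Y : Ω' → ℝ) : Prop :=
  ∀ φ : ℝ → ℝ, ConvexOn ℝ Set.univ φ →
    Integrable (fun ω => φ (X ω)) P → Integrable (fun ω => φ (Y ω)) Q →
      ∫ ω, φ (X ω) ∂P ≤ ∫ ω, φ (Y ω) ∂Q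

/-- The function `b_α(u) = sin(πu) / (sin(παu)^α sin(π(1-α)u)^(1-α))`, for `0 ≤ α < 1` and
`0 < u < 1`. All the sines are then positive, except that for `α = 0` the first factor of the
denominator is `0 ^ 0 = 1`, so that `b_0(u) = 1`. -/
noncomputable def kanterFun (α u : ℝ) : ℝ :=
  Real.sin (Real.pi * u) /
    (Real.sin (Real.pi * α * u) ^ α * Real.sin (Real.pi * (1 - α) * u) ^ (1 - α))

/-! Put `t = π u` and `f y = y * log (sinc y)`. The normalised logarithm `L_α t = log (α ^ α * (1 -
α) ^ (1 - α) * b_α u)` satisfies `t * L_α t = f t - f (α t) - f ((1 - α) t)`, and `t ^ 2 * L_α' t`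
is the same expression with `g y = y ^ 2 * cot y - y` in place of `f`. Both `f` and `g` are concave
on `[0, π)` and vanish at `0`. Concavity makes this defect decrease in `α` on `[0, 1/2]`, and its
quotient by `1 - α` decrease in `α` on `[0, 1)` (`splitDefect_le`, `splitDefect_div_le`).

Applied to `f`, this gives a pointwise comparison of the normalised variables, hence the stochastic
orders. The constant is optimal because every normalised function is at most `1` and tends to `1` as
`u → 0`.

Applied to `g`, it makes the ratio of the function for `α` to the function for `β` decrease in `u`.
Once the means agree, the two functions cross at most once, and since the one for `β` decreases,
this gives the convex order (`convexLE_of_single_crossing`).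

It remains to compute two means. That of `K_α` has an explicit primitive and the reflection formula
for Gamma. That of `K_α ^ (1 / (1 - α))` is the imaginary part of an integral of `(1 + w) ^ (α / (1
- α)) / w` along a curve in the upper half-plane on which `arg w = θ` and `arg (1 + w) = (1 - α) θ`
(`integral_levelCurve`). -/

namespace Kanter

open Real Set Filter Topology

/-! ### Concavity of the two auxiliary functions -/

theorem sinc_pos {y : ℝ} (h0 : 0 ≤ y) (h1 : y < π) : 0 < sinc y := by
  rcases h0.eq_or_lt with rfl | h
  · simp
  · rw [sinc_of_ne_zero h.ne']
    exact div_pos (sin_pos_of_pos_of_lt_pi h h1) h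

theorem hasDerivAt_cot_quotient {y : ℝ} (hs : sin y ≠ 0) :
    HasDerivAt (fun y => cos y / sin y) (-(1 / sin y ^ 2)) y := by
  refine ((hasDerivAt_cos y).div (hasDerivAt_sin y) hs).congr_deriv ?_
  field_simp
  linarith [sin_sq_add_cos_sq y]

/-- The function `y * log (sinc y)`. -/
noncomputable def mulLogSinc (y : ℝ) : ℝ := y * log (sinc y)

/-- The continuous extension of `y ^ 2 * cot y - y` to `[0, π)`. -/
noncomputable def sqCotSub (y : ℝ) : ℝ := y * cos y / sinc y - y

@[simp] theorem mulLogSinc_zero : mulLogSinc 0 = 0 := by simp [mulLogSinc]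

@[simp] theorem sqCotSub_zero : sqCotSub 0 = 0 := by simp [sqCotSub]

theorem hasDerivAt_mulLogSinc {y : ℝ} (h0 : 0 < y) (h1 : y < π) :
    HasDerivAt mulLogSinc (log (sin y) - log y + y * (cos y / sin y) - 1) y := by
  have hs := sin_pos_of_pos_of_lt_pi h0 h1
  have h : HasDerivAt (fun y => y * (log (sin y) - log y))
      (1 * (log (sin y) - log y) + y * (cos y / sin y - 1 / y)) y := by
    have h2 := ((hasDerivAt_sin y).log hs.ne').sub ((hasDerivAt_id y).log h0.ne')
    exact (hasDerivAt_id y).mul h2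
  have h' : HasDerivAt mulLogSinc
      (1 * (log (sin y) - log y) + y * (cos y / sin y - 1 / y)) y := by
    refine h.congr_of_eventuallyEq ?_
    filter_upwards [Ioo_mem_nhds h0 h1] with x hx
    have := sin_pos_of_pos_of_lt_pi hx.1 hx.2
    rw [mulLogSinc, sinc_of_ne_zero hx.1.ne', log_div this.ne' hx.1.ne']
  convert h' using 1
  field_simp
  ring

theorem concaveOn_mulLogSinc : ConcaveOn ℝ (Ico 0 π) mulLogSinc := by
  refine concaveOn_of_hasDerivWithinAt2_nonpos (convex_Ico 0 π)
    (f' := fun y => log (sin y) - log y + y * (cos y / sin y) - 1)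
    (f'' := fun y => cos y / sin y - 1 / y + (1 * (cos y / sin y) + y * (-(1 / sin y ^ 2))))
    ?_ ?_ ?_ ?_
  · unfold mulLogSinc
    exact continuousOn_id.mul (continuous_sinc.continuousOn.log
      fun y hy => (sinc_pos hy.1 hy.2).ne')
  · intro y hy
    rw [interior_Ico] at hy
    exact (hasDerivAt_mulLogSinc hy.1 hy.2).hasDerivWithinAt
  · intro y hy
    rw [interior_Ico] at hy
    have hs := sin_pos_of_pos_of_lt_pi hy.1 hy.2
    exact (((((hasDerivAt_sin y).log hs.ne').sub ((hasDerivAt_id y).log hy.1.ne')).add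
      ((hasDerivAt_id y).mul (hasDerivAt_cot_quotient hs.ne'))).sub_const 1).hasDerivWithinAt
  · intro y hy
    rw [interior_Ico] at hy
    have hs := sin_pos_of_pos_of_lt_pi hy.1 hy.2
    have hy0 := hy.1
    have e : cos y / sin y - 1 / y + (1 * (cos y / sin y) + y * (-(1 / sin y ^ 2)))
        = (2 * y * sin y * cos y - sin y ^ 2 - y ^ 2) / (y * sin y ^ 2) := by
      field_simp
      ring
    rw [e]
    refine div_nonpos_of_nonpos_of_nonneg ?_ (by positivity)
    -- By `cos y ≤ 1`, the numerator is at most `-(y - sin y) ^ 2`.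
    nlinarith [mul_le_mul_of_nonneg_left (cos_le_one y) (mul_pos hy0 hs).le,
      sq_nonneg (y - sin y)]

theorem sqCotSub_of_pos {y : ℝ} (h0 : 0 < y) (h1 : y < π) :
    sqCotSub y = y ^ 2 * (cos y / sin y) - y := by
  have hs := sin_pos_of_pos_of_lt_pi h0 h1
  rw [sqCotSub, sinc_of_ne_zero h0.ne']
  field_simp

theorem mul_cos_le_sin {y : ℝ} (h0 : 0 < y) (h1 : y < π) : y * cos y ≤ sin y := by
  have hs := sin_pos_of_pos_of_lt_pi h0 h1
  rcases lt_or_ge y (π / 2) with h | h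
  · have hc := cos_pos_of_mem_Ioo ⟨by linarith, h⟩
    have := (lt_tan h0 h).le
    rwa [tan_eq_sin_div_cos, le_div_iff₀ hc] at this
  · have := cos_nonpos_of_pi_div_two_le_of_le h (by linarith)
    nlinarith

theorem concaveOn_sqCotSub : ConcaveOn ℝ (Ico 0 π) sqCotSub := by
  refine concaveOn_of_hasDerivWithinAt2_nonpos (convex_Ico 0 π)
    (f' := fun y => 2 * y * (cos y / sin y) + y ^ 2 * (-(1 / sin y ^ 2)) - 1)
    (f'' := fun y => 2 * 1 * (cos y / sin y) + 2 * y * (-(1 / sin y ^ 2)) +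
      (2 * y * (-(1 / sin y ^ 2)) + y ^ 2 * (2 * cos y / sin y ^ 3))) ?_ ?_ ?_ ?_
  · unfold sqCotSub
    exact ((continuous_id.mul continuous_cos).continuousOn.div continuous_sinc.continuousOn
      fun y hy => (sinc_pos hy.1 hy.2).ne').sub continuousOn_id
  · intro y hy
    rw [interior_Ico] at hy
    have hs := sin_pos_of_pos_of_lt_pi hy.1 hy.2
    have h := ((hasDerivAt_pow 2 y).mul (hasDerivAt_cot_quotient hs.ne')).sub (hasDerivAt_id y)
    have h' := h.congr_of_eventuallyEq (f₁ := sqCotSub) (by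
      filter_upwards [Ioo_mem_nhds hy.1 hy.2] with x hx
      rw [sqCotSub_of_pos hx.1 hx.2]
      simp)
    exact (h'.congr_deriv (by simp)).hasDerivWithinAt
  · intro y hy
    rw [interior_Ico] at hy
    have hs := sin_pos_of_pos_of_lt_pi hy.1 hy.2
    have h3 : HasDerivAt (fun y => -(1 / sin y ^ 2)) (2 * cos y / sin y ^ 3) y := by
      have h4 : HasDerivAt (fun y => sin y ^ 2) (2 * sin y * cos y) y := by
        simpa using (hasDerivAt_sin y).fun_pow 2
      have h5 : HasDerivAt (fun y => -(1 / sin y ^ 2)) _ y :=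
        ((hasDerivAt_const y (1 : ℝ)).div h4 (pow_ne_zero 2 hs.ne')).neg
      refine h5.congr_deriv ?_
      field_simp
      ring
    have h := ((((hasDerivAt_id y).const_mul 2).mul (hasDerivAt_cot_quotient hs.ne')).add
      ((hasDerivAt_pow 2 y).mul h3)).sub_const 1
    exact (h.congr_deriv (by simp)).hasDerivWithinAt
  · intro y hy
    rw [interior_Ico] at hy
    have hs := sin_pos_of_pos_of_lt_pi hy.1 hy.2
    have hy0 := hy.1
    have e : 2 * 1 * (cos y / sin y) + 2 * y * (-(1 / sin y ^ 2)) +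
        (2 * y * (-(1 / sin y ^ 2)) + y ^ 2 * (2 * cos y / sin y ^ 3))
        = 2 * (cos y * (sin y ^ 2 + y ^ 2) - 2 * y * sin y) / sin y ^ 3 := by
      field_simp
      ring
    rw [e]
    refine div_nonpos_of_nonpos_of_nonneg ?_ (by positivity)
    have h1 : y * cos y ≤ sin y := mul_cos_le_sin hy.1 hy.2
    have h2 : sin y ≤ y := (sin_lt hy0).le
    -- The factor `y` turns `cos y` into `y * cos y ≤ sin y`, which holds whatever the sign of the
    -- cosine.
    have h3 : y * (cos y * (sin y ^ 2 + y ^ 2)) ≤ y * (2 * y * sin y) := by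
      have : sin y ^ 2 ≤ y ^ 2 := by gcongr
      calc y * (cos y * (sin y ^ 2 + y ^ 2)) = (y * cos y) * (sin y ^ 2 + y ^ 2) := by ring
        _ ≤ sin y * (sin y ^ 2 + y ^ 2) := by gcongr
        _ ≤ sin y * (y ^ 2 + y ^ 2) := by gcongr
        _ = _ := by ring
    have := le_of_mul_le_mul_left h3 hy0
    linarith

/-! ### Monotonicity of the splitting defect in the parameter -/

/-- The defect of additivity of `f` along the splitting `t = α t + (1 - α) t`. -/
def splitDefect (f : ℝ → ℝ) (α t : ℝ) : ℝ := f t - f (α * t) - f ((1 - α) * t)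

/-- Since `α ≤ 1 / 2`, the points `α t` and `(1 - α) t` lie between `β t` and `(1 - β) t` and have
the same sum; a concave function has the larger sum at the inner pair. -/
theorem splitDefect_le {f : ℝ → ℝ} {c t α β : ℝ} (hf : ConcaveOn ℝ (Ico 0 c) f)
    (ht : 0 < t) (htc : t < c) (hβ : 0 ≤ β) (hβα : β < α) (hα : α ≤ 1 / 2) :
    splitDefect f α t ≤ splitDefect f β t := by
  have hx : β * t ∈ Ico 0 c := ⟨by positivity, by nlinarith⟩
  have hy : (1 - β) * t ∈ Ico 0 c := ⟨by nlinarith, by nlinarith⟩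
  have hd : 0 < 1 - 2 * β := by linarith
  set l := (α - β) / (1 - 2 * β) with hl
  have hl0 : 0 ≤ l := div_nonneg (by linarith) hd.le
  have hl1 : l ≤ 1 := by rw [hl, div_le_one hd]; linarith
  have el : l * (1 - 2 * β) = α - β := div_mul_cancel₀ _ hd.ne'
  have h1 := hf.2 hx hy (sub_nonneg.2 hl1) hl0 (by ring)
  have h2 := hf.2 hx hy hl0 (sub_nonneg.2 hl1) (by ring)
  simp only [smul_eq_mul] at h1 h2
  rw [show (1 - l) * (β * t) + l * ((1 - β) * t) = α * t by linear_combination t * el] at h1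
  rw [show l * (β * t) + (1 - l) * ((1 - β) * t) = (1 - α) * t by
    linear_combination (-t) * el] at h2
  unfold splitDefect
  linarith

/-- With `l = (1 - α) / (1 - β)`, the point `α t` is the mixture of `β t` and `t`, and `(1 - α) t`
that of `(1 - β) t` and `0`, both with weights `l` and `1 - l`. Adding the two concavity
inequalities bounds the defect at `α` by `l` times the defect at `β`. -/
theorem splitDefect_div_le {f : ℝ → ℝ} {c t α β : ℝ} (hf : ConcaveOn ℝ (Ico 0 c) f)
    (hf0 : f 0 = 0) (ht : 0 < t) (htc : t < c) (hβ : 0 ≤ β) (hβα : β < α) (hα : α < 1) :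
    splitDefect f α t / (1 - α) ≤ splitDefect f β t / (1 - β) := by
  have ha : 0 < 1 - α := by linarith
  have hb : 0 < 1 - β := by linarith
  have hx : β * t ∈ Ico 0 c := ⟨by positivity, by nlinarith⟩
  have hy : (1 - β) * t ∈ Ico 0 c := ⟨by nlinarith, by nlinarith⟩
  have hz : (0 : ℝ) ∈ Ico 0 c := ⟨le_rfl, by linarith⟩
  have htm : t ∈ Ico 0 c := ⟨ht.le, htc⟩
  set l := (1 - α) / (1 - β) with hl
  have hl0 : 0 ≤ l := div_nonneg ha.le hb.le
  have hl1 : l ≤ 1 := by rw [hl, div_le_one hb]; linarith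
  have el : l * (1 - β) = 1 - α := div_mul_cancel₀ _ hb.ne'
  have h1 := hf.2 hx htm hl0 (sub_nonneg.2 hl1) (by ring)
  have h2 := hf.2 hy hz hl0 (sub_nonneg.2 hl1) (by ring)
  simp only [smul_eq_mul] at h1 h2
  rw [show l * (β * t) + (1 - l) * t = α * t by linear_combination (-t) * el] at h1
  rw [show l * ((1 - β) * t) + (1 - l) * 0 = (1 - α) * t by linear_combination t * el,
    hf0] at h2
  have e : splitDefect f β t / (1 - β) = l * splitDefect f β t / (1 - α) := by
    rw [← el]
    have : l ≠ 0 := (div_pos ha hb).ne'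
    field_simp
  rw [e]
  gcongr
  unfold splitDefect
  linarith

/-! ### The logarithm of the normalised Kanter function -/

/-- The logarithm of `α ^ α * (1 - α) ^ (1 - α) * kanterFun α u` at `t = π * u`. -/
noncomputable def logKanter (α t : ℝ) : ℝ :=
  log (sinc t) - α * log (sinc (α * t)) - (1 - α) * log (sinc ((1 - α) * t))

theorem logKanter_eq {α t : ℝ} (ht : t ≠ 0) :
    logKanter α t = splitDefect mulLogSinc α t / t := by
  unfold logKanter splitDefect mulLogSinc
  field_simp

theorem hasDerivAt_log_sinc_mul {a t : ℝ} (ha : 0 ≤ a) (ha1 : a ≤ 1) (h0 : 0 < t) (h1 : t < π) :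
    HasDerivAt (fun t => a * log (sinc (a * t))) (sqCotSub (a * t) / t ^ 2) t := by
  rcases ha.eq_or_lt with rfl | ha
  · simpa using hasDerivAt_const t (0 : ℝ)
  have h0' : 0 < a * t := by positivity
  have h1' : a * t < π := by nlinarith
  have hs := sin_pos_of_pos_of_lt_pi h0' h1'
  have hm : HasDerivAt (fun t => a * t) a t := by simpa using (hasDerivAt_id t).const_mul a
  have h : HasDerivAt (fun t => a * (log (sin (a * t)) - log (a * t)))
      (a * (cos (a * t) * a / sin (a * t) - a / (a * t))) t :=
    ((hm.sin.log hs.ne').sub (hm.log h0'.ne')).const_mul a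
  have h' := h.congr_of_eventuallyEq (f₁ := fun t => a * log (sinc (a * t))) (by
    filter_upwards [Ioo_mem_nhds h0 h1] with x hx
    have hx0 : 0 < a * x := mul_pos ha hx.1
    have := sin_pos_of_pos_of_lt_pi hx0 (by nlinarith [hx.2])
    rw [sinc_of_ne_zero hx0.ne', log_div this.ne' hx0.ne'])
  refine h'.congr_deriv ?_
  rw [sqCotSub_of_pos h0' h1']
  field_simp

/-- The derivative is again a splitting defect, so the same concavity argument controls monotonicity
in `t`. -/
theorem hasDerivAt_logKanter {α t : ℝ} (hα : 0 ≤ α) (hα1 : α ≤ 1) (h0 : 0 < t) (h1 : t < π) :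
    HasDerivAt (logKanter α) (splitDefect sqCotSub α t / t ^ 2) t := by
  have h := ((hasDerivAt_log_sinc_mul zero_le_one le_rfl h0 h1).sub
    (hasDerivAt_log_sinc_mul hα hα1 h0 h1)).sub
    (hasDerivAt_log_sinc_mul (sub_nonneg.2 hα1) (by linarith) h0 h1)
  simp only [one_mul] at h
  refine HasDerivAt.congr_deriv h ?_
  simp only [splitDefect]
  ring

theorem logKanter_zero_left (t : ℝ) : logKanter 0 t = 0 := by
  simp [logKanter]

theorem logKanter_le {α β t : ℝ} (hβ : 0 ≤ β) (hβα : β < α) (hα : α ≤ 1 / 2)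
    (h0 : 0 < t) (h1 : t < π) : logKanter α t ≤ logKanter β t := by
  rw [logKanter_eq h0.ne', logKanter_eq h0.ne']
  gcongr
  exact splitDefect_le concaveOn_mulLogSinc h0 h1 hβ hβα hα

theorem logKanter_div_le {α β t : ℝ} (hβ : 0 ≤ β) (hβα : β < α) (hα : α < 1)
    (h0 : 0 < t) (h1 : t < π) : logKanter α t / (1 - α) ≤ logKanter β t / (1 - β) := by
  rw [logKanter_eq h0.ne', logKanter_eq h0.ne', div_right_comm, div_right_comm _ t]
  gcongr ?_ / t
  exact splitDefect_div_le concaveOn_mulLogSinc mulLogSinc_zero h0 h1 hβ hβα hα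

theorem antitoneOn_of_hasDerivAt_nonpos_Ioo {f f' : ℝ → ℝ} {a b : ℝ}
    (hf : ∀ x ∈ Ioo a b, HasDerivAt f (f' x) x) (hf' : ∀ x ∈ Ioo a b, f' x ≤ 0) :
    AntitoneOn f (Ioo a b) := by
  refine antitoneOn_of_hasDerivWithinAt_nonpos (f' := f') (convex_Ioo a b)
    (fun x hx => (hf x hx).continuousAt.continuousWithinAt) ?_ ?_
  · rw [interior_Ioo]
    exact fun x hx => (hf x hx).hasDerivWithinAt
  · rw [interior_Ioo]
    exact hf'

theorem antitoneOn_logKanter_sub {α β : ℝ} (hβ : 0 ≤ β) (hβα : β < α) (hα : α ≤ 1 / 2) :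
    AntitoneOn (fun t => logKanter α t - logKanter β t) (Ioo 0 π) := by
  refine antitoneOn_of_hasDerivAt_nonpos_Ioo
    (f' := fun t => splitDefect sqCotSub α t / t ^ 2 - splitDefect sqCotSub β t / t ^ 2)
    (fun t ht => ?_) (fun t ht => ?_)
  · exact (hasDerivAt_logKanter (by linarith) (by linarith) ht.1 ht.2).sub
      (hasDerivAt_logKanter hβ (by linarith) ht.1 ht.2)
  · rw [sub_nonpos]
    gcongr ?_ / t ^ 2
    exact splitDefect_le concaveOn_sqCotSub ht.1 ht.2 hβ hβα hα

theorem antitoneOn_logKanter_div_sub {α β : ℝ} (hβ : 0 ≤ β) (hβα : β < α) (hα : α < 1) :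
    AntitoneOn (fun t => logKanter α t / (1 - α) - logKanter β t / (1 - β)) (Ioo 0 π) := by
  refine antitoneOn_of_hasDerivAt_nonpos_Ioo
    (f' := fun t => splitDefect sqCotSub α t / t ^ 2 / (1 - α) -
      splitDefect sqCotSub β t / t ^ 2 / (1 - β))
    (fun t ht => ?_) (fun t ht => ?_)
  · exact ((hasDerivAt_logKanter (by linarith) (by linarith) ht.1 ht.2).div_const _).sub
      ((hasDerivAt_logKanter hβ (by linarith) ht.1 ht.2).div_const _)
  · rw [sub_nonpos, div_right_comm, div_right_comm _ (t ^ 2)]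
    gcongr ?_ / t ^ 2
    exact splitDefect_div_le concaveOn_sqCotSub sqCotSub_zero ht.1 ht.2 hβ hβα hα

/-- This is the comparison with the parameter `0`, for which `logKanter` vanishes identically. -/
theorem logKanter_div_nonpos {α t : ℝ} (hα : 0 ≤ α) (hα1 : α < 1) (h0 : 0 < t) (h1 : t < π) :
    logKanter α t / (1 - α) ≤ 0 := by
  rcases hα.eq_or_lt with rfl | hα
  · simp [logKanter_zero_left]
  · simpa [logKanter_zero_left] using logKanter_div_le le_rfl hα hα1 h0 h1

theorem logKanter_nonpos {α t : ℝ} (hα : 0 ≤ α) (hα1 : α < 1) (h0 : 0 < t) (h1 : t < π) :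
    logKanter α t ≤ 0 := by
  have h := logKanter_div_nonpos hα hα1 h0 h1
  have h2 : 0 < 1 - α := by linarith
  rw [div_nonpos_iff] at h
  rcases h with h | h
  · linarith [h.2]
  · exact h.1

theorem antitoneOn_logKanter_div {α : ℝ} (hα : 0 ≤ α) (hα1 : α < 1) :
    AntitoneOn (fun t => logKanter α t / (1 - α)) (Ioo 0 π) := by
  rcases hα.eq_or_lt with rfl | hα
  · simpa [logKanter_zero_left] using antitoneOn_const
  · simpa [logKanter_zero_left] using antitoneOn_logKanter_div_sub le_rfl hα hα1

theorem antitoneOn_logKanter {α : ℝ} (hα : 0 ≤ α) (hα1 : α < 1) :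
    AntitoneOn (logKanter α) (Ioo 0 π) := by
  intro x hx y hy hxy
  have h := antitoneOn_logKanter_div hα hα1 hx hy hxy
  exact (div_le_div_iff_of_pos_right (by linarith)).1 h

theorem tendsto_logKanter (α : ℝ) : Tendsto (logKanter α) (𝓝[>] 0) (𝓝 0) := by
  have h : ContinuousAt (logKanter α) 0 := by
    have (a : ℝ) : ContinuousAt (fun t => log (sinc (a * t))) 0 :=
      (continuous_sinc.comp (continuous_const.mul continuous_id)).continuousAt.log (by simp)
    have h1 := this 1
    simp only [one_mul] at h1
    exact (h1.sub ((this α).const_mul α)).sub ((this (1 - α)).const_mul (1 - α))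
  have h0 : logKanter α 0 = 0 := by simp [logKanter]
  rw [ContinuousAt, h0] at h
  exact h.mono_left nhdsWithin_le_nhds

/-! ### Exponential form and integrability of the Kanter function -/

theorem kanterFun_eq {α u : ℝ} (hα : 0 ≤ α) (hα1 : α < 1) (h0 : 0 < u) (h1 : u < 1) :
    α ^ α * (1 - α) ^ (1 - α) * kanterFun α u = exp (logKanter α (π * u)) := by
  have ht0 : 0 < π * u := by positivity
  have ht1 : π * u < π := by nlinarith [pi_pos]
  -- Used for `a = α` and `a = 1 - α`: the two powers of `π * u` multiply to its inverse, which
  -- turns `sin (π * u)` into a `sinc`. The value `a = 0` rests on `0 ^ 0 = 1`.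
  have key : ∀ a : ℝ, 0 ≤ a → a ≤ 1 →
      a ^ a / sin (π * a * u) ^ a = (π * u) ^ (-a) * exp (-(a * log (sinc (a * (π * u))))) := by
    intro a ha ha1
    rcases ha.eq_or_lt with rfl | ha
    · simp
    have hx0 : 0 < a * (π * u) := by positivity
    have hs : 0 < sin (a * (π * u)) := sin_pos_of_pos_of_lt_pi hx0 (by nlinarith)
    rw [show π * a * u = a * (π * u) by ring, sinc_of_ne_zero hx0.ne',
      log_div hs.ne' hx0.ne', log_mul ha.ne' ht0.ne', rpow_def_of_pos ha, rpow_def_of_pos hs,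
      rpow_def_of_pos ht0, ← exp_sub, ← exp_add]
    congr 1
    ring
  have hs : 0 < sin (π * u) := sin_pos_of_pos_of_lt_pi ht0 ht1
  have e : α ^ α * (1 - α) ^ (1 - α) * kanterFun α u =
      sin (π * u) * (α ^ α / sin (π * α * u) ^ α) *
        ((1 - α) ^ (1 - α) / sin (π * (1 - α) * u) ^ (1 - α)) := by
    unfold kanterFun
    ring
  rw [e, key α hα hα1.le, key (1 - α) (by linarith) (by linarith), logKanter,
    sinc_of_ne_zero ht0.ne', log_div hs.ne' ht0.ne', rpow_def_of_pos ht0, rpow_def_of_pos ht0]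
  conv_lhs => rw [← exp_log hs]
  simp only [← exp_add]
  congr 1
  ring

theorem kanterFun_rpow_eq {α u : ℝ} (hα : 0 ≤ α) (hα1 : α < 1) (h0 : 0 < u) (h1 : u < 1) :
    α ^ (α / (1 - α)) * (1 - α) * kanterFun α u ^ (1 / (1 - α)) =
      exp (logKanter α (π * u) / (1 - α)) := by
  have h := kanterFun_eq hα hα1 h0 h1
  have h2 : 0 < 1 - α := by linarith
  have hc : 0 < α ^ α * (1 - α) ^ (1 - α) := by
    rcases hα.eq_or_lt with rfl | hα <;> [simp; positivity]
  have hk : 0 < kanterFun α u := by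
    have := exp_pos (logKanter α (π * u))
    rw [← h] at this
    exact pos_of_mul_pos_right this hc.le
  rw [div_eq_mul_one_div (logKanter _ _), exp_mul, ← h, mul_rpow hc.le hk.le,
    mul_rpow (by positivity) (by positivity), ← rpow_mul hα, ← rpow_mul h2.le,
    mul_one_div_cancel h2.ne', rpow_one, mul_one_div]

theorem measurable_kanterFun (α : ℝ) : Measurable (kanterFun α) := by
  unfold kanterFun
  fun_prop

theorem kanterConst_pos {α : ℝ} (hα : 0 ≤ α) (hα1 : α < 1) : 0 < α ^ α * (1 - α) ^ (1 - α) := by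
  have : 0 < 1 - α := by linarith
  rcases hα.eq_or_lt with rfl | hα <;> [simp; positivity]

theorem pi_mul_mem_Ioo {u : ℝ} (hu : u ∈ Ioo (0 : ℝ) 1) : π * u ∈ Ioo 0 π :=
  ⟨mul_pos pi_pos hu.1, by nlinarith [pi_pos, hu.2]⟩

theorem integrableOn_exp_of_nonpos {f g : ℝ → ℝ} {c : ℝ} (hf : Measurable f) (hc : 0 < c)
    (h : ∀ u ∈ Ioo (0 : ℝ) 1, c * f u = exp (g u)) (hg : ∀ u ∈ Ioo (0 : ℝ) 1, g u ≤ 0) :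
    IntegrableOn f (Ioo 0 1) := by
  refine Measure.integrableOn_of_bounded (M := 1 / c) (by simp) hf.aestronglyMeasurable ?_
  filter_upwards [ae_restrict_mem measurableSet_Ioo] with u hu
  have h1 := h u hu
  have h2 : exp (g u) ≤ 1 := exp_le_one_iff.2 (hg u hu)
  have h3 := exp_pos (g u)
  have h4 : f u = exp (g u) / c := by rw [← h1]; field_simp
  rw [h4, norm_of_nonneg (by positivity)]
  gcongr

theorem integrableOn_kanterFun {α : ℝ} (hα : 0 ≤ α) (hα1 : α < 1) :
    IntegrableOn (kanterFun α) (Ioo 0 1) :=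
  integrableOn_exp_of_nonpos (measurable_kanterFun α) (kanterConst_pos hα hα1)
    (fun _ hu => kanterFun_eq hα hα1 hu.1 hu.2)
    fun _ hu => logKanter_nonpos hα hα1 (pi_mul_mem_Ioo hu).1 (pi_mul_mem_Ioo hu).2

theorem kanterRpowConst_pos {α : ℝ} (hα : 0 ≤ α) (hα1 : α < 1) :
    0 < α ^ (α / (1 - α)) * (1 - α) := by
  have : 0 < 1 - α := by linarith
  rcases hα.eq_or_lt with rfl | hα <;> [simp; positivity]

theorem integrableOn_kanterFun_rpow {α : ℝ} (hα : 0 ≤ α) (hα1 : α < 1) :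
    IntegrableOn (fun u => kanterFun α u ^ (1 / (1 - α))) (Ioo 0 1) :=
  integrableOn_exp_of_nonpos ((measurable_kanterFun α).pow_const _) (kanterRpowConst_pos hα hα1)
    (fun _ hu => kanterFun_rpow_eq hα hα1 hu.1 hu.2)
    fun _ hu => logKanter_div_nonpos hα hα1 (pi_mul_mem_Ioo hu).1 (pi_mul_mem_Ioo hu).2

/-! ### The mean of the Kanter variable -/

theorem sin_mul_pi_mul_pos {a u : ℝ} (ha : 0 < a) (ha1 : a ≤ 1) (hu : u ∈ Ioo (0 : ℝ) 1) :
    0 < sin (π * a * u) := by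
  refine sin_pos_of_pos_of_lt_pi (mul_pos (mul_pos pi_pos ha) hu.1) ?_
  have : a * u < 1 := by nlinarith [hu.1, hu.2]
  nlinarith [pi_pos]

theorem hasDerivAt_sin_rpow {a b u : ℝ} (hs : 0 < sin (π * a * u)) :
    HasDerivAt (fun u => sin (π * a * u) ^ b)
      (π * a * b * (cos (π * a * u) / sin (π * a * u)) * sin (π * a * u) ^ b) u := by
  have h1 : HasDerivAt (fun u => π * a * u) (π * a) u := by
    simpa using (hasDerivAt_id u).const_mul (π * a)
  refine (h1.sin.rpow_const (p := b) (Or.inl hs.ne')).congr_deriv ?_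
  rw [rpow_sub_one hs.ne']
  field_simp

theorem integral_kanterFun {α : ℝ} (hα : 0 < α) (hα1 : α < 1) :
    ∫ u in Ioo (0 : ℝ) 1, kanterFun α u = sin (π * α) / (π * (α * (1 - α))) := by
  have ha : 0 < 1 - α := by linarith
  -- An explicit primitive: with `x = π α u` and `y = π (1 - α) u`, its logarithmic derivative is `π
  -- α (1 - α) (cot x + cot y)`, and `cot x + cot y = sin (x + y) / (sin x * sin y)` with `x + y = π
  -- u`.
  set G : ℝ → ℝ := fun u =>
    sin (π * α * u) ^ (1 - α) * sin (π * (1 - α) * u) ^ α / (π * (α * (1 - α))) with hG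
  have hc : ContinuousOn G (Icc 0 1) := by
    refine Continuous.continuousOn ?_
    have h1 : Continuous fun u => sin (π * α * u) ^ (1 - α) :=
      (by fun_prop : Continuous fun u => sin (π * α * u)).rpow_const fun _ => Or.inr ha.le
    have h2 : Continuous fun u => sin (π * (1 - α) * u) ^ α :=
      (by fun_prop : Continuous fun u => sin (π * (1 - α) * u)).rpow_const fun _ => Or.inr hα.le
    exact (h1.mul h2).div_const _
  have hd : ∀ u ∈ Ioo (0 : ℝ) 1, HasDerivAt G (kanterFun α u) u := by
    intro u hu
    have hx := sin_mul_pi_mul_pos hα hα1.le hu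
    have hy := sin_mul_pi_mul_pos ha (by linarith) hu
    have h := ((hasDerivAt_sin_rpow (b := 1 - α) hx).mul
      (hasDerivAt_sin_rpow (b := α) hy)).div_const (π * (α * (1 - α)))
    refine h.congr_deriv ?_
    have es : sin (π * u) = sin (π * α * u) * cos (π * (1 - α) * u) +
        cos (π * α * u) * sin (π * (1 - α) * u) := by
      rw [← sin_add]
      congr 1
      ring
    unfold kanterFun
    rw [es]
    have e1 : sin (π * α * u) ^ (1 - α) = sin (π * α * u) / sin (π * α * u) ^ α := by
      rw [rpow_sub hx, rpow_one]
    have e2 : sin (π * (1 - α) * u) ^ α =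
        sin (π * (1 - α) * u) / sin (π * (1 - α) * u) ^ (1 - α) := by
      rw [eq_div_iff (rpow_pos_of_pos hy _).ne', ← rpow_add hy]
      simp
    rw [e1, e2]
    have := rpow_pos_of_pos hx α
    have := rpow_pos_of_pos hy (1 - α)
    have := pi_pos
    field_simp
    ring
  have hi : IntervalIntegrable (kanterFun α) volume 0 1 := by
    rw [intervalIntegrable_iff_integrableOn_Ioo_of_le zero_le_one]
    exact integrableOn_kanterFun hα.le hα1
  have h := intervalIntegral.integral_eq_sub_of_hasDerivAt_of_le zero_le_one hc hd hi
  rw [← integral_Ioc_eq_integral_Ioo, ← intervalIntegral.integral_of_le zero_le_one, h, hG]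
  have hs : 0 < sin (π * α) := sin_pos_of_pos_of_lt_pi (by positivity) (by nlinarith [pi_pos])
  have e : sin (π * (1 - α)) = sin (π * α) := by
    rw [← sin_pi_sub]
    congr 1
    ring
  simp only [mul_one, mul_zero, sin_zero, e]
  rw [← rpow_add hs, zero_rpow ha.ne']
  simp

theorem gamma_mul_integral_kanterFun {α : ℝ} (hα : 0 ≤ α) (hα1 : α < 1) :
    ∫ u in Ioo (0 : ℝ) 1, Gamma (1 + α) * Gamma (2 - α) * kanterFun α u = 1 := by
  rcases hα.eq_or_lt with rfl | hα
  · rw [setIntegral_congr_fun (g := fun _ => (1 : ℝ)) measurableSet_Ioo]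
    · simp
    · intro u hu
      have : 0 < sin (π * u) := by simpa using sin_mul_pi_mul_pos zero_lt_one le_rfl hu
      simp [kanterFun, this.ne']
  · have ha : 0 < 1 - α := by linarith
    have hs : 0 < sin (π * α) := sin_pos_of_pos_of_lt_pi (by positivity) (by nlinarith [pi_pos])
    rw [integral_const_mul, integral_kanterFun hα hα1, add_comm 1 α,
      show 2 - α = (1 - α) + 1 by ring, Gamma_add_one hα.ne', Gamma_add_one ha.ne',
      show α * Gamma α * ((1 - α) * Gamma (1 - α)) = α * (1 - α) * (Gamma α * Gamma (1 - α)) by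
        ring, Gamma_mul_Gamma_one_sub]
    have := pi_pos
    field_simp
    rw [mul_comm α π, div_self hs.ne']

/-! ### The mean of the power `1 / (1 - α)` by integration along a level curve -/

/-- On the upper half-plane this is a primitive of `((1 + w) ^ p - 1) / w`. -/
noncomputable def cpowPrimitive (p : ℝ) (w : ℂ) : ℂ :=
  ∫ t in (0 : ℝ)..1, ((1 + t * w) ^ (p : ℂ) - 1) / t

theorem one_add_mul_mem_slitPlane {w : ℂ} (hw : 0 < w.im) (t : ℝ) :
    1 + t * w ∈ Complex.slitPlane := by
  rcases eq_or_ne t 0 with rfl | ht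
  · simp
  · refine Or.inr ?_
    simp [ht, hw.ne']

theorem continuous_one_add_mul_cpow {w : ℂ} (hw : 0 < w.im) (q : ℂ) :
    Continuous (fun t : ℝ => (1 + t * w) ^ q) :=
  Continuous.cpow (by fun_prop) continuous_const fun t => one_add_mul_mem_slitPlane hw t

theorem hasDerivAt_one_add_mul_cpow {w : ℂ} (hw : 0 < w.im) (t p : ℝ) :
    HasDerivAt (fun t : ℝ => (1 + t * w) ^ (p : ℂ)) (p * (1 + t * w) ^ ((p : ℂ) - 1) * w) t := by
  have h1 : HasDerivAt (fun z : ℂ => 1 + z * w) w (t : ℂ) := by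
    simpa using ((hasDerivAt_id (t : ℂ)).mul_const w).const_add 1
  exact (h1.cpow_const (one_add_mul_mem_slitPlane hw t)).comp_ofReal

theorem intervalIntegrable_cpow_sub_one_div {w : ℂ} (hw : 0 < w.im) (p : ℝ) :
    IntervalIntegrable (fun t : ℝ => ((1 + t * w) ^ (p : ℂ) - 1) / t) volume 0 1 := by
  -- The singularity at `t = 0` is removable: the integrand is a difference quotient of `(1 + t w) ^
  -- p` at `0`.
  have hc : ContinuousOn (dslope (fun t : ℝ => (1 + t * w) ^ (p : ℂ)) 0) univ :=
    (continuousOn_dslope univ_mem).2 ⟨(continuous_one_add_mul_cpow hw p).continuousOn,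
      (hasDerivAt_one_add_mul_cpow hw 0 p).differentiableAt⟩
  refine (hc.mono (subset_univ (uIcc 0 1))).intervalIntegrable.congr ?_
  intro t ht
  rw [uIoc_of_le zero_le_one] at ht
  simp only [dslope_of_ne _ ht.1.ne', slope_def_module, sub_zero, Complex.real_smul,
    Complex.ofReal_zero, zero_mul, add_zero, Complex.one_cpow, Complex.ofReal_inv]
  rw [inv_mul_eq_div]

/-- Differentiation under the integral cancels the factor `1 / t`; what remains, times `w`, is the
`t`-derivative of `(1 + t w) ^ p`. -/
theorem hasDerivAt_cpowPrimitive {w : ℂ} (hw : 0 < w.im) (p : ℝ) :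
    HasDerivAt (cpowPrimitive p) (((1 + w) ^ (p : ℂ) - 1) / w) w := by
  have hw0 : w ≠ 0 := by
    rintro rfl
    simp at hw
  set s : Set ℂ := Metric.closedBall w (w.im / 2) with hs
  have hs_im : ∀ z ∈ s, 0 < z.im := by
    intro z hz
    have h1 : |(z - w).im| ≤ w.im / 2 :=
      (Complex.abs_im_le_norm _).trans (by simpa [hs, dist_eq_norm] using hz)
    rw [Complex.sub_im] at h1
    linarith [(abs_le.1 h1).1]
  obtain ⟨C, hC⟩ : ∃ C, ∀ x ∈ Icc (0 : ℝ) 1 ×ˢ s,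
      ‖(p : ℂ) * (1 + x.1 * x.2) ^ ((p : ℂ) - 1)‖ ≤ C := by
    refine (isCompact_Icc.prod (isCompact_closedBall w (w.im / 2))).exists_bound_of_continuousOn ?_
    refine continuousOn_const.mul (ContinuousOn.cpow_const ?_ ?_)
    · exact Continuous.continuousOn (by fun_prop)
    · exact fun x hx => one_add_mul_mem_slitPlane (hs_im _ hx.2) _
  have hmem : s ∈ 𝓝 w := Metric.closedBall_mem_nhds w (by positivity)
  have key := intervalIntegral.hasDerivAt_integral_of_dominated_loc_of_deriv_le
    (𝕜 := ℂ) (μ := volume) (a := 0) (b := 1) (x₀ := w) (s := s)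
    (F := fun z t => ((1 + t * z) ^ (p : ℂ) - 1) / t)
    (F' := fun z t => p * (1 + t * z) ^ ((p : ℂ) - 1)) (bound := fun _ => C) hmem
    (by
      filter_upwards [hmem] with z hz
      rw [uIoc_of_le zero_le_one]
      exact (intervalIntegrable_cpow_sub_one_div (hs_im z hz) p).1.aestronglyMeasurable)
    (intervalIntegrable_cpow_sub_one_div hw p)
    ((continuous_const.mul (continuous_one_add_mul_cpow hw _)).aestronglyMeasurable)
    (Eventually.of_forall fun t ht z hz => by
      rw [uIoc_of_le zero_le_one] at ht
      exact hC (t, z) ⟨⟨ht.1.le, ht.2⟩, hz⟩)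
    intervalIntegrable_const
    (Eventually.of_forall fun t ht z hz => by
      rw [uIoc_of_le zero_le_one] at ht
      have ht0 : (t : ℂ) ≠ 0 := Complex.ofReal_ne_zero.2 ht.1.ne'
      have h1 : HasDerivAt (fun z : ℂ => 1 + t * z) t z := by
        simpa using ((hasDerivAt_id z).const_mul (t : ℂ)).const_add 1
      refine (((h1.cpow_const (c := (p : ℂ)) (one_add_mul_mem_slitPlane (hs_im z hz) t)).sub_const
        1).div_const (t : ℂ)).congr_deriv ?_
      field_simp)
  refine HasDerivAt.congr_deriv (f := cpowPrimitive p) key.2 ?_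
  have hI := intervalIntegral.integral_eq_sub_of_hasDerivAt (a := 0) (b := 1)
    (fun t _ => hasDerivAt_one_add_mul_cpow hw t p)
    (((continuous_const.mul (continuous_one_add_mul_cpow hw _)).mul
      continuous_const).intervalIntegrable 0 1)
  rw [intervalIntegral.integral_mul_const] at hI
  rw [eq_div_iff hw0, hI]
  simp

/-- A bound uniform in `t` and in `w` near a real point `≥ -1`, serving as the dominating function
for the boundary limit. It holds because the argument of `1 + t w` is `O(t)`. -/
theorem im_cpow_div_le {p : ℝ} (hp : 0 < p) {w : ℂ} (hw : 0 < w.im) (hw1 : w.im ≤ 1)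
    (hre : -(3 / 2) ≤ w.re) {B : ℝ} (hB : ‖w‖ ≤ B) {t : ℝ} (ht : t ∈ Ioc (0 : ℝ) 1) :
    ‖(((1 + t * w) ^ (p : ℂ) - 1) / t : ℂ).im‖ ≤ (1 + B) ^ p * (p * (4 + 2 * π)) := by
  set y : ℂ := 1 + t * w with hy
  have hyim : y.im = t * w.im := by simp [hy]
  have hyre : y.re = 1 + t * w.re := by simp [hy]
  have hyim0 : 0 < y.im := by rw [hyim]; exact mul_pos ht.1 hw
  have harg0 : 0 ≤ y.arg := Complex.arg_nonneg_iff.2 hyim0.le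
  -- For `t ≤ 1 / 2` the real part of `y` is at least `1 / 4`, so `arg y ≤ tan (arg y) ≤ 4 t`; for
  -- `t > 1 / 2`, `arg y ≤ π ≤ 2 π t`.
  have harg : y.arg ≤ t * (4 + 2 * π) := by
    rcases le_or_gt t (1 / 2) with h | h
    · have hr : 1 / 4 ≤ y.re := by rw [hyre]; nlinarith [ht.1]
      have h1 : y.arg < π / 2 := Complex.arg_lt_pi_div_two_iff.2 (Or.inl (by linarith))
      have h2 := le_tan harg0 h1
      rw [Complex.tan_arg] at h2
      have h3 : y.im / y.re ≤ 4 * t := by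
        rw [div_le_iff₀ (by linarith), hyim]
        nlinarith [ht.1]
      nlinarith [mul_pos ht.1 pi_pos]
    · nlinarith [y.arg_le_pi, pi_pos]
  have hnorm : ‖y‖ ≤ 1 + B := by
    calc ‖y‖ ≤ ‖(1 : ℂ)‖ + ‖(t : ℂ) * w‖ := norm_add_le _ _
      _ ≤ 1 + B := by
        rw [norm_one, norm_mul, Complex.norm_real, norm_of_nonneg ht.1.le]
        nlinarith [norm_nonneg w, ht.2]
  rw [Complex.div_ofReal_im, Complex.sub_im, Complex.cpow_ofReal_im, Complex.one_im, sub_zero,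
    norm_div, norm_mul, norm_of_nonneg ht.1.le, norm_of_nonneg (by positivity), div_le_iff₀ ht.1,
    norm_eq_abs]
  have hB0 : 0 ≤ B := (norm_nonneg w).trans hB
  have h4 : |sin (y.arg * p)| ≤ t * (4 + 2 * π) * p :=
    (abs_sin_le_abs).trans (by
      rw [abs_of_nonneg (by positivity)]
      gcongr)
  calc ‖y‖ ^ p * |sin (y.arg * p)| ≤ (1 + B) ^ p * (t * (4 + 2 * π) * p) := by gcongr
    _ = _ := by ring

/-- At a real point `x ≥ -1` the base `1 + t x` is positive for `t < 1`, so the integrand becomes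
real. This kills the boundary terms at both ends of the level curve. -/
theorem tendsto_im_cpowPrimitive {p : ℝ} (hp : 0 < p) {x : ℝ} (hx : -1 ≤ x) :
    Tendsto (fun w => (cpowPrimitive p w).im) (𝓝[{w | 0 < w.im}] (x : ℂ)) (𝓝 0) := by
  have hnear : ∀ᶠ w : ℂ in 𝓝[{w | 0 < w.im}] (x : ℂ),
      0 < w.im ∧ w.im ≤ 1 ∧ -(3 / 2) ≤ w.re ∧ ‖w‖ ≤ |x| + 1 := by
    filter_upwards [self_mem_nhdsWithin,
      nhdsWithin_le_nhds (Metric.ball_mem_nhds (x : ℂ) (by norm_num : (0 : ℝ) < 1 / 2))]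
      with w hw hb
    have hd : ‖w - x‖ < 1 / 2 := by simpa [dist_eq_norm] using hb
    have h1 := abs_lt.1 ((Complex.abs_im_le_norm (w - x)).trans_lt hd)
    have h2 := abs_lt.1 ((Complex.abs_re_le_norm (w - x)).trans_lt hd)
    simp only [Complex.sub_im, Complex.sub_re, Complex.ofReal_im, Complex.ofReal_re] at h1 h2
    refine ⟨hw, by linarith, by linarith, ?_⟩
    have h3 := norm_add_le (w - x) x
    rw [sub_add_cancel, Complex.norm_real, norm_eq_abs] at h3
    linarith
  have hlim := intervalIntegral.tendsto_integral_filter_of_dominated_convergence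
    (μ := volume) (a := 0) (b := 1) (l := 𝓝[{w | 0 < w.im}] (x : ℂ))
    (F := fun w t => (((1 + t * w) ^ (p : ℂ) - 1) / t : ℂ).im) (f := fun _ => (0 : ℝ))
    (fun _ => (1 + (|x| + 1)) ^ p * (p * (4 + 2 * π)))
    (by
      filter_upwards [self_mem_nhdsWithin] with w hw
      rw [uIoc_of_le zero_le_one]
      exact (Complex.measurable_im.comp_aemeasurable
        (intervalIntegrable_cpow_sub_one_div hw p).1.aestronglyMeasurable.aemeasurable
        ).aestronglyMeasurable)
    (by
      filter_upwards [hnear] with w hw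
      refine Eventually.of_forall fun t ht => ?_
      rw [uIoc_of_le zero_le_one] at ht
      exact im_cpow_div_le hp hw.1 hw.2.1 hw.2.2.1 hw.2.2.2 ht)
    intervalIntegrable_const
    (by
      -- The point `t = 1` is discarded because `1 + t x` vanishes there when `x = -1`.
      filter_upwards [compl_mem_ae_iff.2 (measure_singleton (1 : ℝ))] with t ht1 ht
      rw [uIoc_of_le zero_le_one] at ht
      have ht1 : t < 1 := lt_of_le_of_ne ht.2 ht1
      have hpos : 0 < 1 + t * x := by nlinarith [ht.1]
      have hc : ContinuousAt (fun w : ℂ => (((1 + t * w) ^ (p : ℂ) - 1) / t : ℂ).im) (x : ℂ) := by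
        refine Complex.continuous_im.continuousAt.comp ?_
        refine ((ContinuousAt.cpow ?_ continuousAt_const ?_).sub continuousAt_const).div_const _
        · fun_prop
        · exact Or.inl (by simpa using hpos)
      have h0 : (((1 + t * (x : ℂ)) ^ (p : ℂ) - 1) / t : ℂ).im = 0 := by
        have : (1 + t * (x : ℂ)) = ((1 + t * x : ℝ) : ℂ) := by push_cast; ring
        rw [this, ← Complex.ofReal_cpow hpos.le, Complex.div_ofReal_im, Complex.sub_im]
        simp
      have h1 := hc.tendsto.mono_left (nhdsWithin_le_nhds (s := {w : ℂ | 0 < w.im}))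
      rwa [h0] at h1)
  rw [intervalIntegral.integral_zero] at hlim
  refine hlim.congr' ?_
  filter_upwards [self_mem_nhdsWithin] with w hw
  exact Complex.imCLM.intervalIntegral_comp_comm (intervalIntegrable_cpow_sub_one_div hw p)

/-- The level curve on which the argument of `1 + w` is `(1 - α) θ`. -/
noncomputable def levelCurve (α θ : ℝ) : ℂ :=
  (sin ((1 - α) * θ) / sin (α * θ) : ℝ) * Complex.exp (θ * Complex.I)

theorem one_add_levelCurve {α θ : ℝ} (h : sin (α * θ) ≠ 0) :
    1 + levelCurve α θ = (sin θ / sin (α * θ) : ℝ) *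
      (cos ((1 - α) * θ) + sin ((1 - α) * θ) * Complex.I) := by
  have e : θ = α * θ + (1 - α) * θ := by ring
  unfold levelCurve
  rw [Complex.exp_mul_I, ← Complex.ofReal_cos, ← Complex.ofReal_sin]
  generalize (1 - α) * θ = b at *
  generalize α * θ = a at *
  subst e
  apply Complex.ext
  · simp only [Complex.add_re, Complex.mul_re, Complex.add_im, Complex.mul_im, Complex.ofReal_re,
      Complex.ofReal_im, Complex.I_re, Complex.I_im, Complex.one_re, mul_zero, mul_one,
      zero_mul, sub_zero, add_zero, zero_add]
    field_simp
    rw [cos_add, sin_add]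
    linear_combination (-sin a) * sin_sq_add_cos_sq b
  · simp only [Complex.add_re, Complex.mul_re, Complex.add_im, Complex.mul_im, Complex.ofReal_re,
      Complex.ofReal_im, Complex.I_re, Complex.I_im, Complex.one_im, mul_zero, mul_one,
      zero_mul, sub_zero, add_zero, zero_add]
    field_simp

theorem levelCurve_im (α θ : ℝ) :
    (levelCurve α θ).im = sin ((1 - α) * θ) / sin (α * θ) * sin θ := by
  unfold levelCurve
  rw [Complex.exp_mul_I, ← Complex.ofReal_cos, ← Complex.ofReal_sin]
  simp only [Complex.add_re, Complex.mul_re, Complex.add_im, Complex.mul_im, Complex.ofReal_re,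
    Complex.ofReal_im, Complex.I_re, Complex.I_im, mul_zero, mul_one,
    zero_mul, sub_zero, add_zero, zero_add]

theorem hasDerivAt_levelCurve {α θ : ℝ} (ha : sin (α * θ) ≠ 0) (hb : sin ((1 - α) * θ) ≠ 0) :
    HasDerivAt (levelCurve α) (levelCurve α θ *
      (((1 - α) * (cos ((1 - α) * θ) / sin ((1 - α) * θ)) - α * (cos (α * θ) / sin (α * θ)) : ℝ)
        + Complex.I)) θ := by
  have h1 (c : ℝ) : HasDerivAt (fun θ => c * θ) c θ := by
    simpa using (hasDerivAt_id θ).const_mul c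
  have h2 := ((h1 (1 - α)).sin.div (h1 α).sin ha).ofReal_comp
  have h3 : HasDerivAt (fun θ : ℝ => Complex.exp (θ * Complex.I))
      (Complex.exp (θ * Complex.I) * Complex.I) θ := by
    have : HasDerivAt (fun θ : ℝ => (θ : ℂ) * Complex.I) Complex.I θ := by
      simpa using (hasDerivAt_id θ).ofReal_comp.mul_const Complex.I
    exact this.cexp
  refine (h2.mul h3).congr_deriv ?_
  unfold levelCurve
  have ha' : (sin (α * θ) : ℂ) ≠ 0 := by exact_mod_cast ha
  have hb' : (sin ((1 - α) * θ) : ℂ) ≠ 0 := by exact_mod_cast hb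
  simp only [Complex.ofReal_div, Complex.ofReal_sub, Complex.ofReal_mul, Complex.ofReal_pow,
    Pi.div_apply] at *
  field_simp

theorem sin_mul_pos {a θ : ℝ} (ha : 0 < a) (ha1 : a ≤ 1) (hθ : θ ∈ Ioo 0 π) :
    0 < sin (a * θ) :=
  sin_pos_of_pos_of_lt_pi (mul_pos ha hθ.1) (by nlinarith [hθ.1, hθ.2])

/-- The angle `(1 - α) θ` is the principal argument of `1 + w`, and the exponent `α / (1 - α)` turns
it into `α θ`. -/
theorem one_add_levelCurve_cpow {α θ : ℝ} (hα : 0 < α) (hα1 : α < 1) (hθ : θ ∈ Ioo 0 π) :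
    (1 + levelCurve α θ) ^ ((α / (1 - α) : ℝ) : ℂ) =
      ((sin θ / sin (α * θ)) ^ (α / (1 - α)) : ℝ) * (cos (α * θ) + sin (α * θ) * Complex.I) := by
  have ha : 0 < 1 - α := by linarith
  have hsa := sin_mul_pos hα hα1.le hθ
  have hs := sin_pos_of_pos_of_lt_pi hθ.1 hθ.2
  have hR : 0 < sin θ / sin (α * θ) := div_pos hs hsa
  have hmem : (1 - α) * θ ∈ Ioc (-π) π :=
    ⟨by nlinarith [hθ.1, pi_pos, mul_pos ha hθ.1], by nlinarith [hθ.1, hθ.2]⟩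
  rw [one_add_levelCurve hsa.ne', Complex.cpow_ofReal, Complex.ofReal_cos ((1 - α) * θ),
    Complex.ofReal_sin ((1 - α) * θ), Complex.arg_mul_cos_add_sin_mul_I hR hmem, norm_mul,
    Complex.norm_cos_add_sin_mul_I, mul_one, Complex.norm_real, norm_of_nonneg hR.le,
    show (1 - α) * θ * (α / (1 - α)) = α * θ by field_simp]

theorem levelCurve_im_pos {α θ : ℝ} (hα : 0 < α) (hα1 : α < 1) (hθ : θ ∈ Ioo 0 π) :
    0 < (levelCurve α θ).im := by
  have hsa := sin_mul_pos hα hα1.le hθ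
  have hsb := sin_mul_pos (sub_pos.2 hα1) (by linarith) hθ
  have hs := sin_pos_of_pos_of_lt_pi hθ.1 hθ.2
  rw [levelCurve_im]
  positivity

/-- Along the curve `dw / w` has imaginary part `dθ`, so the added `θ` compensates the `-1` in the
primitive's integrand and leaves `Im ((1 + w) ^ p dw / w)`. With `a = α θ` and `b = (1 - α) θ`, the
angular factor is `(1 - α) (sin a * cot b + cos a) = (1 - α) sin θ / sin b`. -/
theorem hasDerivAt_im_cpowPrimitive_levelCurve {α θ : ℝ} (hα : 0 < α) (hα1 : α < 1)
    (hθ : θ ∈ Ioo 0 π) :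
    HasDerivAt (fun θ => θ + (cpowPrimitive (α / (1 - α)) (levelCurve α θ)).im)
      ((1 - α) * ((sin θ / sin (α * θ)) ^ (α / (1 - α)) * (sin θ / sin ((1 - α) * θ)))) θ := by
  have hsa := sin_mul_pos hα hα1.le hθ
  have hsb := sin_mul_pos (sub_pos.2 hα1) (by linarith) hθ
  have him := levelCurve_im_pos hα hα1 hθ
  have hw0 : levelCurve α θ ≠ 0 := by
    intro h
    simp [h] at him
  have h1 := (hasDerivAt_cpowPrimitive him (α / (1 - α))).comp θ
    (hasDerivAt_levelCurve hsa.ne' hsb.ne')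
  have h2 := (hasDerivAt_id θ).add (Complex.imCLM.hasFDerivAt.comp_hasDerivAt θ h1)
  refine HasDerivAt.congr_deriv h2 ?_
  rw [one_add_levelCurve_cpow hα hα1 hθ, div_mul_eq_mul_div, mul_div_assoc,
    mul_div_cancel_left₀ _ hw0]
  have es : sin θ = sin (α * θ) * cos ((1 - α) * θ) + cos (α * θ) * sin ((1 - α) * θ) := by
    rw [← sin_add]
    congr 1
    ring
  generalize (sin θ / sin (α * θ)) ^ (α / (1 - α)) = r
  rw [es]
  simp only [Complex.imCLM_apply, Complex.mul_im, Complex.sub_re, Complex.sub_im, Complex.add_re,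
    Complex.add_im, Complex.mul_re, Complex.ofReal_re, Complex.ofReal_im, Complex.I_re,
    Complex.I_im, Complex.one_re, Complex.one_im]
  clear h1 h2 es
  generalize sin ((1 - α) * θ) = y at hsb ⊢
  field_simp
  ring

theorem tendsto_levelCurve_zero {α : ℝ} (hα : 0 < α) :
    Tendsto (levelCurve α) (𝓝[>] 0) (𝓝 (((1 - α) / α : ℝ) : ℂ)) := by
  have hc : ContinuousAt (fun θ : ℝ => (((1 - α) * sinc ((1 - α) * θ) / (α * sinc (α * θ)) : ℝ) : ℂ)
      * Complex.exp (θ * Complex.I)) 0 := by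
    refine ContinuousAt.mul (Complex.continuous_ofReal.continuousAt.comp ?_) (by fun_prop)
    refine ContinuousAt.div ?_ ?_ (by simp [hα.ne'])
    · exact (continuous_const.mul (continuous_sinc.comp (continuous_const.mul
        continuous_id))).continuousAt
    · exact (continuous_const.mul (continuous_sinc.comp (continuous_const.mul
        continuous_id))).continuousAt
  have h := hc.tendsto.mono_left (nhdsWithin_le_nhds (s := Ioi 0))
  simp only [mul_zero, sinc_zero, mul_one, Complex.ofReal_zero, zero_mul, Complex.exp_zero] at h
  refine h.congr' ?_
  filter_upwards [self_mem_nhdsWithin] with θ hθ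
  have hθ0 : θ ≠ 0 := (mem_Ioi.1 hθ).ne'
  have e : ∀ a : ℝ, a * sinc (a * θ) = sin (a * θ) / θ := by
    intro a
    rcases eq_or_ne a 0 with rfl | ha
    · simp
    · rw [sinc_of_ne_zero (mul_ne_zero ha hθ0)]
      field_simp
  rw [e, e, div_div_div_cancel_right₀ hθ0]
  rfl

theorem tendsto_levelCurve_pi {α : ℝ} (hα : 0 < α) (hα1 : α < 1) :
    Tendsto (levelCurve α) (𝓝[<] π) (𝓝 ((-1 : ℝ) : ℂ)) := by
  have hs : 0 < sin (α * π) := sin_pos_of_pos_of_lt_pi (by positivity) (by nlinarith [pi_pos])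
  have hc : ContinuousAt (levelCurve α) π := by
    refine ContinuousAt.mul (Complex.continuous_ofReal.continuousAt.comp ?_) (by fun_prop)
    exact ContinuousAt.div (by fun_prop) (by fun_prop) hs.ne'
  have e : levelCurve α π = ((-1 : ℝ) : ℂ) := by
    rw [levelCurve, show (1 - α) * π = π - α * π by ring, sin_pi_sub, div_self hs.ne',
      Complex.exp_pi_mul_I]
    simp
  have h := hc.tendsto.mono_left (nhdsWithin_le_nhds (s := Iio π))
  rwa [e] at h

/-- The curve runs from `(1 - α) / α` to `-1`; at both ends the imaginary part of the primitive
tends to `0`, so only the increment `π` of `θ` survives. -/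
theorem integral_levelCurve {α : ℝ} (hα : 0 < α) (hα1 : α < 1)
    (hi : IntervalIntegrable (fun θ => (1 - α) * ((sin θ / sin (α * θ)) ^ (α / (1 - α)) *
      (sin θ / sin ((1 - α) * θ)))) volume 0 π) :
    ∫ θ in (0 : ℝ)..π, (1 - α) * ((sin θ / sin (α * θ)) ^ (α / (1 - α)) *
      (sin θ / sin ((1 - α) * θ))) = π := by
  have ha : 0 < 1 - α := by linarith
  have hp : 0 < α / (1 - α) := div_pos hα ha
  have h0 : ∀ᶠ θ in 𝓝[>] (0 : ℝ), levelCurve α θ ∈ {w : ℂ | 0 < w.im} := by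
    filter_upwards [Ioo_mem_nhdsGT pi_pos] with θ hθ using levelCurve_im_pos hα hα1 hθ
  have h1 : ∀ᶠ θ in 𝓝[<] π, levelCurve α θ ∈ {w : ℂ | 0 < w.im} := by
    filter_upwards [Ioo_mem_nhdsLT pi_pos] with θ hθ using levelCurve_im_pos hα hα1 hθ
  have hx : -1 ≤ (1 - α) / α := by
    have : 0 < (1 - α) / α := by positivity
    linarith
  have t0 := (tendsto_id.mono_left (nhdsWithin_le_nhds (a := (0 : ℝ)) (s := Ioi 0))).add
    ((tendsto_im_cpowPrimitive hp hx).comp (tendsto_nhdsWithin_iff.2 ⟨tendsto_levelCurve_zero hα, h0⟩))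
  have t1 := (tendsto_id.mono_left (nhdsWithin_le_nhds (a := π) (s := Iio π))).add
    ((tendsto_im_cpowPrimitive hp le_rfl).comp
      (tendsto_nhdsWithin_iff.2 ⟨tendsto_levelCurve_pi hα hα1, h1⟩))
  rw [intervalIntegral.integral_eq_sub_of_hasDerivAt_of_tendsto pi_pos
    (fun θ hθ => hasDerivAt_im_cpowPrimitive_levelCurve hα hα1 hθ) hi t0 t1]
  simp

theorem kanterFun_rpow_eq_div {α u : ℝ} (hα : 0 < α) (hα1 : α < 1) (hu : u ∈ Ioo (0 : ℝ) 1) :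
    kanterFun α u ^ (1 / (1 - α)) = (sin (π * u) / sin (α * (π * u))) ^ (α / (1 - α)) *
      (sin (π * u) / sin ((1 - α) * (π * u))) := by
  have ha : 0 < 1 - α := by linarith
  have hθ := pi_mul_mem_Ioo hu
  have hsa := sin_mul_pos hα hα1.le hθ
  have hsb := sin_mul_pos ha (by linarith) hθ
  have hs := sin_pos_of_pos_of_lt_pi hθ.1 hθ.2
  have e1 : 1 / (1 - α) = α / (1 - α) + 1 := by field_simp; ring
  rw [kanterFun, show π * α * u = α * (π * u) by ring,
    show π * (1 - α) * u = (1 - α) * (π * u) by ring, div_rpow hs.le (by positivity),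
    mul_rpow (by positivity) (by positivity), ← rpow_mul hsa.le, ← rpow_mul hsb.le,
    mul_one_div_cancel ha.ne', rpow_one, mul_one_div, e1, rpow_add_one hs.ne',
    div_rpow hs.le hsa.le]
  field_simp

theorem integral_kanterFun_rpow {α : ℝ} (hα : 0 ≤ α) (hα1 : α < 1) :
    ∫ u in Ioo (0 : ℝ) 1, (1 - α) * kanterFun α u ^ (1 / (1 - α)) = 1 := by
  have ha : 0 < 1 - α := by linarith
  rcases hα.eq_or_lt with rfl | hα
  · rw [setIntegral_congr_fun (g := fun _ => (1 : ℝ)) measurableSet_Ioo]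
    · simp
    · intro u hu
      have : 0 < sin (π * u) := by simpa using sin_mul_pi_mul_pos zero_lt_one le_rfl hu
      simp [kanterFun, this.ne']
  · set g : ℝ → ℝ := fun θ => (1 - α) * ((sin θ / sin (α * θ)) ^ (α / (1 - α)) *
      (sin θ / sin ((1 - α) * θ))) with hg
    have hcongr : EqOn (fun u => (1 - α) * kanterFun α u ^ (1 / (1 - α)))
        (fun u => g (π * u)) (Ioo 0 1) := by
      intro u hu
      simp only [hg, kanterFun_rpow_eq_div hα hα1 hu]
    have hi : IntervalIntegrable (fun u => g (π * u)) volume 0 1 := by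
      rw [intervalIntegrable_iff_integrableOn_Ioo_of_le zero_le_one]
      exact IntegrableOn.congr_fun ((integrableOn_kanterFun_rpow hα.le hα1).const_mul (1 - α))
        hcongr measurableSet_Ioo
    have hi' : IntervalIntegrable g volume 0 π := by
      have := hi.comp_mul_left (c := π⁻¹)
      simpa [← mul_assoc, mul_inv_cancel₀ pi_ne_zero] using this
    rw [setIntegral_congr_fun measurableSet_Ioo hcongr, ← integral_Ioc_eq_integral_Ioo,
      ← intervalIntegral.integral_of_le zero_le_one,
      intervalIntegral.integral_comp_mul_left g pi_ne_zero, mul_zero, mul_one,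
      integral_levelCurve hα hα1 hi']
    simp [pi_ne_zero]

/-! ### Criteria for the orders between functions of a uniform variable -/

section Orders

variable {Ω Ω' : Type*} [MeasurableSpace Ω] [MeasurableSpace Ω'] {P : Measure Ω} {Q : Measure Ω'}
  {U : Ω → ℝ} {V : Ω' → ℝ} {F G : ℝ → ℝ}

theorem map_eq_of_isUniform (hU : pdf.IsUniform U (Ioo (0 : ℝ) 1) P volume) :
    P.map U = volume.restrict (Ioo 0 1) := by
  rw [hU, ProbabilityTheory.cond]
  simp

theorem aemeasurable_of_isUniform (hU : pdf.IsUniform U (Ioo (0 : ℝ) 1) P volume) :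
    AEMeasurable U P :=
  hU.aemeasurable (by simp) (by simp)

theorem integral_comp_of_isUniform (hU : pdf.IsUniform U (Ioo (0 : ℝ) 1) P volume)
    (hF : Measurable F) : ∫ ω, F (U ω) ∂P = ∫ u in Ioo 0 1, F u := by
  rw [← map_eq_of_isUniform hU,
    integral_map (aemeasurable_of_isUniform hU) hF.aestronglyMeasurable]

theorem integrable_comp_of_isUniform (hU : pdf.IsUniform U (Ioo (0 : ℝ) 1) P volume)
    (hF : Measurable F) : Integrable (fun ω => F (U ω)) P ↔ IntegrableOn F (Ioo 0 1) := by
  rw [IntegrableOn, ← map_eq_of_isUniform hU,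
    integrable_map_measure hF.aestronglyMeasurable (aemeasurable_of_isUniform hU)]
  rfl

theorem ae_mem_of_isUniform (hU : pdf.IsUniform U (Ioo (0 : ℝ) 1) P volume) :
    ∀ᵐ ω ∂P, U ω ∈ Ioo (0 : ℝ) 1 := by
  refine ae_of_ae_map (aemeasurable_of_isUniform hU) ?_
  rw [map_eq_of_isUniform hU]
  exact ae_restrict_mem measurableSet_Ioo

theorem stochLE_of_le (hU : pdf.IsUniform U (Ioo (0 : ℝ) 1) P volume)
    (hV : pdf.IsUniform V (Ioo (0 : ℝ) 1) Q volume) (hF : Measurable F) (hG : Measurable G)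
    (h : ∀ u ∈ Ioo (0 : ℝ) 1, F u ≤ G u) :
    StochLE P (fun ω => F (U ω)) Q (fun ω => G (V ω)) := by
  intro φ hφ h1 h2
  have hFm : Measurable fun u => φ (F u) := hφ.measurable.comp hF
  have hGm : Measurable fun u => φ (G u) := hφ.measurable.comp hG
  rw [integrable_comp_of_isUniform hU hFm] at h1
  rw [integrable_comp_of_isUniform hV hGm] at h2
  rw [integral_comp_of_isUniform hU hFm, integral_comp_of_isUniform hV hGm]
  exact setIntegral_mono_on h1 h2 measurableSet_Ioo fun u hu => hφ (h u hu)

theorem not_stochLE_const_mul (hU : pdf.IsUniform U (Ioo (0 : ℝ) 1) P volume)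
    (hV : pdf.IsUniform V (Ioo (0 : ℝ) 1) Q volume) (hF : Measurable F) (hG : Measurable G)
    (hF1 : Tendsto F (𝓝[>] 0) (𝓝 1)) (hG1 : ∀ u ∈ Ioo (0 : ℝ) 1, G u ≤ 1) :
    ¬ ∃ c : ℝ, 1 < c ∧ StochLE P (fun ω => c * F (U ω)) Q (fun ω => G (V ω)) := by
  rintro ⟨c, hc, h⟩
  -- This test function has mean zero against `G ≤ 1`, but positive mean against `c * F`, which
  -- exceeds `1` near `0`.
  set φ : ℝ → ℝ := indicator (Ioi 1) 1 with hφ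
  have hmono : Monotone φ := by
    intro x y hxy
    by_cases hx : 1 < x
    · simp [hφ, hx, hx.trans_le hxy]
    · simp only [hφ, indicator_of_notMem (show x ∉ Ioi 1 from hx)]
      exact indicator_nonneg (by simp) _
  have hφ01 : ∀ x, ‖φ x‖ ≤ 1 := by
    intro x
    by_cases hx : 1 < x <;> simp [hφ, hx]
  have hFm : Measurable fun u => φ (c * F u) := hmono.measurable.comp (hF.const_mul c)
  have hGm : Measurable fun u => φ (G u) := hmono.measurable.comp hG
  have hFi : IntegrableOn (fun u => φ (c * F u)) (Ioo 0 1) :=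
    Measure.integrableOn_of_bounded (M := 1) (by simp) hFm.aestronglyMeasurable
      (Eventually.of_forall fun _ => hφ01 _)
  have hGi : IntegrableOn (fun u => φ (G u)) (Ioo 0 1) :=
    Measure.integrableOn_of_bounded (M := 1) (by simp) hGm.aestronglyMeasurable
      (Eventually.of_forall fun _ => hφ01 _)
  have key := h φ hmono ((integrable_comp_of_isUniform hU hFm).2 hFi)
    ((integrable_comp_of_isUniform hV hGm).2 hGi)
  rw [integral_comp_of_isUniform hU hFm, integral_comp_of_isUniform hV hGm,
    setIntegral_congr_fun (f := fun u => φ (G u)) (g := fun _ => (0 : ℝ)) measurableSet_Ioo (fun u hu => by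
      simp [hφ, hG1 u hu])] at key
  have hev : ∀ᶠ u in 𝓝[>] (0 : ℝ), 1 < c * F u := by
    have := hF1.const_mul c
    rw [mul_one] at this
    exact this.eventually (lt_mem_nhds hc)
  obtain ⟨ε, hε, hε'⟩ := mem_nhdsGT_iff_exists_Ioo_subset.1
    (hev.and (Ioo_mem_nhdsGT (zero_lt_one (α := ℝ))))
  have hsub : Ioo 0 ε ⊆ Ioo (0 : ℝ) 1 := fun u hu => (hε' hu).2
  have h1 : ∫ u in Ioo 0 ε, φ (c * F u) ≤ ∫ u in Ioo 0 1, φ (c * F u) :=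
    setIntegral_mono_set hFi (Eventually.of_forall fun u => indicator_nonneg (by simp) _)
      (Eventually.of_forall hsub)
  rw [setIntegral_congr_fun (f := fun u => φ (c * F u)) (g := fun _ => (1 : ℝ)) measurableSet_Ioo (fun u hu => by
      simp [hφ, (hε' hu).1])] at h1
  have hε0 : 0 < ε := hε
  simp [hε0.le] at h1 key
  linarith

theorem optStochLE_of_le (hU : pdf.IsUniform U (Ioo (0 : ℝ) 1) P volume)
    (hV : pdf.IsUniform V (Ioo (0 : ℝ) 1) Q volume) (hF : Measurable F) (hG : Measurable G)
    (hF0 : ∀ u ∈ Ioo (0 : ℝ) 1, 0 < F u) (h : ∀ u ∈ Ioo (0 : ℝ) 1, F u ≤ G u)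
    (hF1 : Tendsto F (𝓝[>] 0) (𝓝 1)) (hG1 : ∀ u ∈ Ioo (0 : ℝ) 1, G u ≤ 1) :
    OptStochLE P (fun ω => F (U ω)) Q (fun ω => G (V ω)) := by
  refine ⟨?_, ?_, stochLE_of_le hU hV hF hG h, not_stochLE_const_mul hU hV hF hG hF1 hG1⟩
  · filter_upwards [ae_mem_of_isUniform hU] with ω hω using hF0 _ hω
  · filter_upwards [ae_mem_of_isUniform hV] with ω hω using (hF0 _ hω).trans_le (h _ hω)

/-- The right derivative at `c` serves as `q`: chords to the right of `c` have slope at least `q`,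
chords to the left at most `q`. -/
theorem _root_.ConvexOn.exists_slope_bound {φ : ℝ → ℝ} (hφ : ConvexOn ℝ univ φ) (c : ℝ) :
    ∃ q : ℝ, ∀ x y : ℝ, (c ≤ x ∧ x ≤ y) ∨ (y ≤ x ∧ x ≤ c) → q * (y - x) ≤ φ y - φ x := by
  refine ⟨derivWithin φ (Ioi c) c, fun x y h => ?_⟩
  have hc : c ∈ interior (univ : Set ℝ) := by simp
  rcases h with ⟨hcx, hxy⟩ | ⟨hyx, hxc⟩
  · rcases hxy.eq_or_lt with rfl | hxy
    · simp
    have h1 : derivWithin φ (Ioi c) c ≤ slope φ x y := by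
      rcases hcx.eq_or_lt with rfl | hcx
      · exact hφ.rightDeriv_le_slope_of_mem_interior hc (mem_univ _) hxy
      · refine (hφ.rightDeriv_le_slope_of_mem_interior hc (mem_univ _) hcx).trans ?_
        simpa [slope_def_field] using hφ.slope_mono_adjacent (mem_univ _) (mem_univ _) hcx hxy
    rwa [slope_def_field, le_div_iff₀ (sub_pos.2 hxy)] at h1
  · rcases hyx.eq_or_lt with rfl | hyx
    · simp
    have h1 : slope φ y x ≤ derivWithin φ (Ioi c) c := by
      rcases hxc.eq_or_lt with rfl | hxc
      · exact (hφ.slope_le_leftDeriv_of_mem_interior (mem_univ _) hc hyx).trans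
          (hφ.leftDeriv_le_rightDeriv_of_mem_interior hc)
      · refine le_trans ?_ ((hφ.slope_le_leftDeriv_of_mem_interior (mem_univ _) hc hxc).trans
          (hφ.leftDeriv_le_rightDeriv_of_mem_interior hc))
        simpa [slope_def_field] using hφ.slope_mono_adjacent (mem_univ _) (mem_univ _) hyx hxc
    rw [slope_def_field, div_le_iff₀ (sub_pos.2 hyx)] at h1
    linarith

/-- The cut criterion. Let `c` separate the values of `F` where `F ≤ G` from those where `G < F`. In
the first case `c ≤ F ≤ G`, in the second `G < F ≤ c`, so in both `φ (G) - φ (F) ≥ q * (G - F)`. The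
right side integrates to zero by equality of means. -/
theorem convexLE_of_single_crossing (hU : pdf.IsUniform U (Ioo (0 : ℝ) 1) P volume)
    (hV : pdf.IsUniform V (Ioo (0 : ℝ) 1) Q volume) (hF : Measurable F) (hG : Measurable G)
    (hFi : IntegrableOn F (Ioo 0 1)) (hGi : IntegrableOn G (Ioo 0 1))
    (hmean : ∫ u in Ioo (0 : ℝ) 1, F u = ∫ u in Ioo (0 : ℝ) 1, G u)
    (hanti : AntitoneOn F (Ioo 0 1)) (hF0 : ∀ u ∈ Ioo (0 : ℝ) 1, 0 ≤ F u) {C : ℝ}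
    (hFC : ∀ u ∈ Ioo (0 : ℝ) 1, F u ≤ C)
    (hcross : ∀ u ∈ Ioo (0 : ℝ) 1, ∀ v ∈ Ioo (0 : ℝ) 1, u ≤ v → F v ≤ G v → F u ≤ G u) :
    ConvexLE Q (fun ω => F (V ω)) P (fun ω => G (U ω)) := by
  intro φ hφ h1 h2
  have hφm : Measurable φ := hφ.locallyLipschitz.continuous.measurable
  have hFm : Measurable fun u => φ (F u) := hφm.comp hF
  have hGm : Measurable fun u => φ (G u) := hφm.comp hG
  rw [integrable_comp_of_isUniform hV hFm] at h1
  rw [integrable_comp_of_isUniform hU hGm] at h2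
  rw [integral_comp_of_isUniform hV hFm, integral_comp_of_isUniform hU hGm]
  -- The supremum of `S` is the cut level. Inserting `0` keeps `S` nonempty when `G < F` never
  -- occurs, and is harmless since `F ≥ 0`.
  set S : Set ℝ := insert 0 (F '' {u ∈ Ioo (0 : ℝ) 1 | G u < F u}) with hS
  have hC0 : 0 ≤ C := (hF0 (1 / 2) (by norm_num)).trans (hFC _ (by norm_num))
  have hbdd : BddAbove S := by
    refine ⟨C, ?_⟩
    rintro x (rfl | ⟨u, hu, rfl⟩)
    · exact hC0
    · exact hFC u hu.1
  obtain ⟨q, hq⟩ := hφ.exists_slope_bound (sSup S)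
  have hpt : ∀ u ∈ Ioo (0 : ℝ) 1, q * (G u - F u) ≤ φ (G u) - φ (F u) := by
    intro u hu
    rcases le_or_gt (F u) (G u) with h | h
    · refine hq _ _ (Or.inl ⟨csSup_le (insert_nonempty _ _) ?_, h⟩)
      rintro x (rfl | ⟨v, hv, rfl⟩)
      · exact hF0 u hu
      · refine hanti hu hv.1 (le_of_not_ge fun hvu => ?_)
        exact (hcross v hv.1 u hu hvu h).not_gt hv.2
    · exact hq _ _ (Or.inr ⟨h.le, le_csSup hbdd (mem_insert_of_mem _ ⟨u, ⟨hu, h⟩, rfl⟩)⟩)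
  have key := setIntegral_mono_on ((hGi.sub hFi).const_mul q) (h2.sub h1) measurableSet_Ioo hpt
  simp only [Pi.sub_apply] at key
  rw [integral_const_mul, integral_sub hGi hFi, integral_sub h2 h1, hmean, sub_self,
    mul_zero] at key
  linarith

end Orders

/-- Functions of a uniform variable with equal means and antitone ratio are convexly ordered. -/
theorem convexLE_of_antitoneOn_log_ratio {Ω Ω' : Type*} [MeasurableSpace Ω] [MeasurableSpace Ω']
    {P : Measure Ω} {Q : Measure Ω'} {U : Ω → ℝ} {V : Ω' → ℝ}
    (hU : pdf.IsUniform U (Ioo (0 : ℝ) 1) P volume)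
    (hV : pdf.IsUniform V (Ioo (0 : ℝ) 1) Q volume) {F G p q : ℝ → ℝ} {a b : ℝ}
    (ha : 0 < a) (hb : 0 < b) (hF : Measurable F) (hG : Measurable G)
    (hFi : IntegrableOn F (Ioo 0 1)) (hGi : IntegrableOn G (Ioo 0 1))
    (hmean : ∫ u in Ioo (0 : ℝ) 1, F u = ∫ u in Ioo (0 : ℝ) 1, G u)
    (hFp : ∀ u ∈ Ioo (0 : ℝ) 1, F u = a * exp (p (π * u)))
    (hGq : ∀ u ∈ Ioo (0 : ℝ) 1, G u = b * exp (q (π * u)))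
    (hp : AntitoneOn p (Ioo 0 π)) (hp0 : ∀ t ∈ Ioo 0 π, p t ≤ 0)
    (hpq : AntitoneOn (fun t => q t - p t) (Ioo 0 π)) :
    ConvexLE Q (fun ω => F (V ω)) P (fun ω => G (U ω)) := by
  refine convexLE_of_single_crossing hU hV hF hG hFi hGi hmean (C := a) ?_ ?_ ?_ ?_
  · intro u hu v hv huv
    rw [hFp u hu, hFp v hv]
    have := hp (pi_mul_mem_Ioo hu) (pi_mul_mem_Ioo hv) (by gcongr)
    gcongr
  · intro u hu
    rw [hFp u hu]
    positivity
  · intro u hu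
    rw [hFp u hu]
    exact mul_le_of_le_one_right ha.le (exp_le_one_iff.2 (hp0 _ (pi_mul_mem_Ioo hu)))
  · intro u hu v hv huv
    have h := hpq (pi_mul_mem_Ioo hu) (pi_mul_mem_Ioo hv) (by gcongr)
    simp only at h
    rw [hFp u hu, hFp v hv, hGq u hu, hGq v hv]
    -- The crossing condition depends only on the ratio of the two functions, which is monotone.
    have e : ∀ t, a * exp (p t) ≤ b * exp (q t) ↔ a ≤ b * exp (q t - p t) := by
      intro t
      rw [exp_sub, mul_div_assoc', le_div_iff₀ (exp_pos _)]
    rw [e, e]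
    intro hle
    exact hle.trans (by gcongr)

theorem tendsto_exp_logKanter_div (α c : ℝ) :
    Tendsto (fun u => exp (logKanter α (π * u) / c)) (𝓝[>] 0) (𝓝 1) := by
  have h1 : Tendsto (fun u => π * u) (𝓝[>] (0 : ℝ)) (𝓝[>] 0) := by
    refine tendsto_nhdsWithin_iff.2 ⟨?_, ?_⟩
    · have : Continuous fun u : ℝ => π * u := by fun_prop
      simpa using (this.tendsto 0).mono_left (nhdsWithin_le_nhds (s := Ioi 0))
    · filter_upwards [self_mem_nhdsWithin] with u hu using mul_pos pi_pos hu
  have h2 := ((tendsto_logKanter α).comp h1).div_const c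
  simpa [Function.comp_def] using (continuous_exp.tendsto _).comp h2

theorem eq_div_mul_exp {c k l x : ℝ} (hc : 0 < c) (h : c * x = exp l) :
    k * x = k / c * exp l := by
  rw [← h]
  field_simp

end Kanter

/-! ### The four orderings -/

open Real Set Filter Topology Kanter in
theorem theorem2 {Ω Ω' : Type*} [MeasurableSpace Ω] [MeasurableSpace Ω']
    (P : Measure Ω) [IsProbabilityMeasure P] (Q : Measure Ω') [IsProbabilityMeasure Q]
    (U : Ω → ℝ) (V : Ω' → ℝ)
    (hU : pdf.IsUniform U (Set.Ioo (0 : ℝ) 1) P volume)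
    (hV : pdf.IsUniform V (Set.Ioo (0 : ℝ) 1) Q volume) :
    (∀ α β : ℝ, 0 ≤ β → β < α → α ≤ 1 / 2 →
      OptStochLE
        P (fun ω => α ^ α * (1 - α) ^ (1 - α) * kanterFun α (U ω))
        Q (fun ω => β ^ β * (1 - β) ^ (1 - β) * kanterFun β (V ω)) ∧
      ConvexLE
        Q (fun ω => Real.Gamma (1 + β) * Real.Gamma (2 - β) * kanterFun β (V ω))
        P (fun ω => Real.Gamma (1 + α) * Real.Gamma (2 - α) * kanterFun α (U ω))) ∧
    (∀ α β : ℝ, 0 ≤ β → β < α → α < 1 →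
      OptStochLE
        P (fun ω => α ^ (α / (1 - α)) * (1 - α) * kanterFun α (U ω) ^ (1 / (1 - α)))
        Q (fun ω => β ^ (β / (1 - β)) * (1 - β) * kanterFun β (V ω) ^ (1 / (1 - β))) ∧
      ConvexLE
        Q (fun ω => (1 - β) * kanterFun β (V ω) ^ (1 / (1 - β)))
        P (fun ω => (1 - α) * kanterFun α (U ω) ^ (1 / (1 - α)))) := by
  refine ⟨fun α β hβ hβα hα => ?_, fun α β hβ hβα hα1 => ?_⟩
  · have hα0 : 0 ≤ α := by linarith
    have hα1 : α < 1 := by linarith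
    have hβ1 : β < 1 := by linarith
    have hmα := measurable_kanterFun α
    have hmβ := measurable_kanterFun β
    have eα := fun u (hu : u ∈ Ioo (0 : ℝ) 1) => kanterFun_eq hα0 hα1 hu.1 hu.2
    have eβ := fun u (hu : u ∈ Ioo (0 : ℝ) 1) => kanterFun_eq hβ hβ1 hu.1 hu.2
    constructor
    · refine optStochLE_of_le hU hV (F := fun u => α ^ α * (1 - α) ^ (1 - α) * kanterFun α u)
        (G := fun u => β ^ β * (1 - β) ^ (1 - β) * kanterFun β u)
        (hmα.const_mul _) (hmβ.const_mul _) ?_ ?_ ?_ ?_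
      · intro u hu
        rw [eα u hu]
        positivity
      · intro u hu
        rw [eα u hu, eβ u hu]
        have ht := pi_mul_mem_Ioo hu
        exact exp_le_exp.2 (logKanter_le hβ hβα hα ht.1 ht.2)
      · refine (tendsto_exp_logKanter_div α 1).congr' ?_
        filter_upwards [Ioo_mem_nhdsGT (zero_lt_one (α := ℝ))] with u hu
        rw [eα u hu, div_one]
      · intro u hu
        have ht := pi_mul_mem_Ioo hu
        rw [eβ u hu]
        exact exp_le_one_iff.2 (logKanter_nonpos hβ hβ1 ht.1 ht.2)
    · have hΓ : ∀ x : ℝ, 0 ≤ x → x < 1 → 0 < Gamma (1 + x) * Gamma (2 - x) := fun x h0 h1 =>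
        mul_pos (Gamma_pos_of_pos (by linarith)) (Gamma_pos_of_pos (by linarith))
      have cα := kanterConst_pos hα0 hα1
      have cβ := kanterConst_pos hβ hβ1
      exact convexLE_of_antitoneOn_log_ratio hU hV (div_pos (hΓ β hβ hβ1) cβ)
        (div_pos (hΓ α hα0 hα1) cα) (hmβ.const_mul _) (hmα.const_mul _)
        ((integrableOn_kanterFun hβ hβ1).const_mul _)
        ((integrableOn_kanterFun hα0 hα1).const_mul _)
        ((gamma_mul_integral_kanterFun hβ hβ1).trans
          (gamma_mul_integral_kanterFun hα0 hα1).symm)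
        (fun u hu => eq_div_mul_exp cβ (eβ u hu)) (fun u hu => eq_div_mul_exp cα (eα u hu))
        (antitoneOn_logKanter hβ hβ1) (fun t ht => logKanter_nonpos hβ hβ1 ht.1 ht.2)
        (antitoneOn_logKanter_sub hβ hβα hα)
  · have hα0 : 0 ≤ α := by linarith
    have hβ1 : β < 1 := by linarith
    have hmα := (measurable_kanterFun α).pow_const (1 / (1 - α))
    have hmβ := (measurable_kanterFun β).pow_const (1 / (1 - β))
    have eα := fun u (hu : u ∈ Ioo (0 : ℝ) 1) => kanterFun_rpow_eq hα0 hα1 hu.1 hu.2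
    have eβ := fun u (hu : u ∈ Ioo (0 : ℝ) 1) => kanterFun_rpow_eq hβ hβ1 hu.1 hu.2
    constructor
    · refine optStochLE_of_le hU hV
        (F := fun u => α ^ (α / (1 - α)) * (1 - α) * kanterFun α u ^ (1 / (1 - α)))
        (G := fun u => β ^ (β / (1 - β)) * (1 - β) * kanterFun β u ^ (1 / (1 - β)))
        (hmα.const_mul _) (hmβ.const_mul _) ?_ ?_ ?_ ?_
      · intro u hu
        rw [eα u hu]
        positivity
      · intro u hu
        rw [eα u hu, eβ u hu]
        have ht := pi_mul_mem_Ioo hu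
        exact exp_le_exp.2 (logKanter_div_le hβ hβα hα1 ht.1 ht.2)
      · refine (tendsto_exp_logKanter_div α (1 - α)).congr' ?_
        filter_upwards [Ioo_mem_nhdsGT (zero_lt_one (α := ℝ))] with u hu
        rw [eα u hu]
      · intro u hu
        have ht := pi_mul_mem_Ioo hu
        rw [eβ u hu]
        exact exp_le_one_iff.2 (logKanter_div_nonpos hβ hβ1 ht.1 ht.2)
    · have cα := kanterRpowConst_pos hα0 hα1
      have cβ := kanterRpowConst_pos hβ hβ1
      exact convexLE_of_antitoneOn_log_ratio hU hV (p := fun t => logKanter β t / (1 - β))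
        (q := fun t => logKanter α t / (1 - α)) (div_pos (sub_pos.2 hβ1) cβ)
        (div_pos (sub_pos.2 hα1) cα) (hmβ.const_mul _) (hmα.const_mul _)
        ((integrableOn_kanterFun_rpow hβ hβ1).const_mul _)
        ((integrableOn_kanterFun_rpow hα0 hα1).const_mul _)
        ((integral_kanterFun_rpow hβ hβ1).trans (integral_kanterFun_rpow hα0 hα1).symm)
        (fun u hu => eq_div_mul_exp cβ (eβ u hu)) (fun u hu => eq_div_mul_exp cα (eα u hu))
        (antitoneOn_logKanter_div hβ hβ1) (fun t ht => logKanter_div_nonpos hβ hβ1 ht.1 ht.2)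
        (antitoneOn_logKanter_div_sub hβ hβα hα1)
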